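/- All vector lattices are real. Let $E$ be a Dedekind complete vector lattice (every non-empty subset that is bounded above has a supremum). Let $\mathcal L_{\mathrm{ob}}(E)$ be the vector lattice of order bounded linear operators on $E$, ordered by $T\le S$ if and only if $Tx\le Sx$ for all $x\ge 0$, and let $\mathrm{Orth}(E)$ be its vector sublattice of orthomorphisms, i.e. of those order bounded operators that map every band of $E$ into itself. A net $(x_\alpha)$ in a vector lattice $X$ is *order convergent* to $x\in X$ if there is a net $(y_\beta)$ in $X$, possibly with a different index set, such that $y_\beta\downarrow 0$ and such that for every $\beta_0$ there is an $\alpha_0$ with $|x-x_\alpha|\le y_{\beta_0}$ for all $\alpha\ge\alpha_0$. It is *unbounded order (uo) convergent* to $x$ in $X$ if, for every $y\in X$ with $y\ge 0$, the net $(|x_\alpha-x|\wedge y)$ is order convergent to $0$ in $X$. For $S\subseteq E$, let $B_S$ denote the band in $E$ generated by $S$. **Theorem.** Let $E$ be a Dedekind complete vector lattice, let $(T_\alpha)_{\alpha\in A}$ be a net in $\mathrm{Orth}(E)$, and let $S$ be a non-empty subset of $E$ such that $B_S=E$. Then the following are equivalent: 1. $(T_\alpha)$ is uo convergent to $0$ in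 $\mathrm{Orth}(E)$; 2. $(T_\alpha)$ is uo convergent to $0$ in $\mathcal L_{\mathrm{ob}}(E)$; 3. $(T_\alpha s)$ is uo convergent to $0$ in $E$ for all $s\in S$; 4. $(T_\alpha x)$ is uo convergent to $0$ in $E$ for all $x\in E$. In particular, when $E$ has a weak order unit $e$ (an element $e$ with $B_{\{e\}}=E$), then $(T_\alpha)$ is uo convergent to $0$ in $\mathrm{Orth}(E)$ if and only if $(T_\alpha e)$ is uo convergent to $0$ in $E$. -/

import Mathlib

namespace VectorLattice

universe u v w

/-! ### Order convergence and unbounded order convergence of nets -/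

section Convergence

variable {X : Type u} [Lattice X] [AddCommGroup X] {ι : Type v} [Preorder ι]

/-- The net `x` converges in order to `l`: there is a net `y`, with an index set `B` of its own,
such that `y` decreases to `0` and every `y b` eventually dominates `|l - x a|`.
Passing from `y` to the downward directed set of its values shows that it makes no difference
in which universe `B` lives; we use the one of `X`. -/
def OrderTendsto (x : ι → X) (l : X) : Prop :=
  ∃ (B : Type u) (_ : Preorder B) (_ : IsDirectedOrder B) (_ : Nonempty B) (y : B → X),
    Antitone y ∧ IsGLB (Set.range y) 0 ∧
      ∀ b₀ : B, ∃ a₀ : ι, ∀ a : ι, a₀ ≤ a → |l - x a| ≤ y b₀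

/-- The net `x` is unbounded order convergent to `l`: `|x a - l| ⊓ y` converges in order to `0`
for every `y ≥ 0`. -/
def UOTendsto (x : ι → X) (l : X) : Prop :=
  ∀ y : X, 0 ≤ y → OrderTendsto (fun a => |x a - l| ⊓ y) 0

end Convergence

/-! ### Bands -/

section Bands

variable {E : Type u} [Lattice E] [AddCommGroup E] [Module ℝ E]

/-- A band: a solid linear subspace (that is, an ideal) which contains the supremum of each of its
subsets that has a supremum in the ambient vector lattice. -/
structure IsBand (B : Submodule ℝ E) : Prop where
  solid : LatticeOrderedAddCommGroup.IsSolid (B : Set E)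
  mem_of_isLUB : ∀ (D : Set E) (x : E), D ⊆ B → IsLUB D x → x ∈ B

/-- The band generated by a subset: the intersection of all bands that contain it. -/
def bandGenerated (S : Set E) : Submodule ℝ E :=
  sInf {B : Submodule ℝ E | IsBand B ∧ S ⊆ B}

theorem isBand_bandGenerated (S : Set E) : IsBand (bandGenerated S) where
  solid x hx y hyx := by
    simp only [bandGenerated, SetLike.mem_coe, Submodule.mem_sInf] at hx ⊢
    exact fun B hB => hB.1.solid (hx B hB) hyx
  mem_of_isLUB D x hD hx := by
    simp only [bandGenerated, Submodule.mem_sInf]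
    exact fun B hB => hB.1.mem_of_isLUB D x
      (fun d hd => (Submodule.mem_sInf.1 (hD hd)) B hB) hx

/-- A weak order unit: an element that generates the whole space as a band. -/
def IsWeakOrderUnit (e : E) : Prop :=
  bandGenerated {e} = ⊤

end Bands

/-! ### The vector lattice of order bounded operators -/

section OrderBounded

variable (E : Type u) [Lattice E] [AddCommGroup E] [Module ℝ E]
variable (F : Type v) [Lattice F] [AddCommGroup F] [IsOrderedAddMonoid F] [Module ℝ F]
  [IsOrderedModule ℝ F]

/-- The order bounded linear operators from `E` into `F`: those that map order bounded sets to
order bounded sets. -/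
def orderBoundedOperators : Submodule ℝ (E →ₗ[ℝ] F) where
  carrier := {T | ∀ s : Set E, BddBelow s → BddAbove s → BddBelow (T '' s) ∧ BddAbove (T '' s)}
  zero_mem' := fun s _ _ => by
    refine ⟨⟨0, ?_⟩, ⟨0, ?_⟩⟩ <;> rintro _ ⟨x, -, rfl⟩ <;> simp
  add_mem' := by
    intro T S hT hS s h₁ h₂
    obtain ⟨⟨a, ha⟩, ⟨b, hb⟩⟩ := hT s h₁ h₂
    obtain ⟨⟨c, hc⟩, ⟨d, hd⟩⟩ := hS s h₁ h₂
    refine ⟨⟨a + c, ?_⟩, ⟨b + d, ?_⟩⟩ <;> rintro _ ⟨x, hx, rfl⟩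
    · exact add_le_add (ha ⟨x, hx, rfl⟩) (hc ⟨x, hx, rfl⟩)
    · exact add_le_add (hb ⟨x, hx, rfl⟩) (hd ⟨x, hx, rfl⟩)
  smul_mem' := by
    intro r T hT s h₁ h₂
    obtain ⟨⟨a, ha⟩, ⟨b, hb⟩⟩ := hT s h₁ h₂
    rcases le_total 0 r with hr | hr
    · refine ⟨⟨r • a, ?_⟩, ⟨r • b, ?_⟩⟩ <;> rintro _ ⟨x, hx, rfl⟩
      · exact smul_le_smul_of_nonneg_left (ha ⟨x, hx, rfl⟩) hr
      · exact smul_le_smul_of_nonneg_left (hb ⟨x, hx, rfl⟩) hr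
    · refine ⟨⟨r • b, ?_⟩, ⟨r • a, ?_⟩⟩ <;> rintro _ ⟨x, hx, rfl⟩
      · exact smul_le_smul_of_nonpos_left (hb ⟨x, hx, rfl⟩) hr
      · exact smul_le_smul_of_nonpos_left (ha ⟨x, hx, rfl⟩) hr

end OrderBounded

section Order

variable {E : Type u} [Lattice E] [AddCommGroup E] [IsOrderedAddMonoid E] [Module ℝ E]
variable {F : Type v} [Lattice F] [AddCommGroup F] [IsOrderedAddMonoid F] [Module ℝ F]
  [IsOrderedModule ℝ F]

/-- The operator order: `T ≤ S` when `T x ≤ S x` for all `x ≥ 0`. -/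
instance instPartialOrderOrderBounded : PartialOrder (orderBoundedOperators E F) where
  le T S := ∀ x : E, 0 ≤ x → T.1 x ≤ S.1 x
  le_refl T x _ := le_rfl
  le_trans T S R h₁ h₂ x hx := (h₁ x hx).trans (h₂ x hx)
  le_antisymm T S h₁ h₂ := by
    apply Subtype.ext
    ext x
    have h : ∀ z : E, 0 ≤ z → T.1 z = S.1 z := fun z hz => le_antisymm (h₁ z hz) (h₂ z hz)
    rw [← posPart_sub_negPart x, map_sub, map_sub, h _ (posPart_nonneg x), h _ (negPart_nonneg x)]

theorem le_def {T S : orderBoundedOperators E F} :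
    T ≤ S ↔ ∀ x : E, 0 ≤ x → T.1 x ≤ S.1 x := Iff.rfl

end Order

section RieszKantorovich

open scoped Pointwise

set_option linter.unusedSectionVars false

variable {E : Type u} [Lattice E] [AddCommGroup E] [IsOrderedAddMonoid E] [Module ℝ E]
  [IsOrderedModule ℝ E]
variable {F : Type v} [ConditionallyCompleteLattice F] [AddCommGroup F] [IsOrderedAddMonoid F]
  [Module ℝ F] [IsOrderedModule ℝ F]

/-- The Riesz-Kantorovich formula for the positive part of `T` on the positive cone. -/
noncomputable def rk (T : orderBoundedOperators E F) (x : E) : F :=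
  sSup (T.1 '' Set.Icc 0 x)

theorem rk_isLUB (T : orderBoundedOperators E F) {x : E} (hx : 0 ≤ x) :
    IsLUB (T.1 '' Set.Icc 0 x) (rk T x) :=
  isLUB_csSup ((Set.nonempty_Icc.2 hx).image _) (T.2 _ bddBelow_Icc bddAbove_Icc).2

theorem rk_nonneg (T : orderBoundedOperators E F) {x : E} (hx : 0 ≤ x) : 0 ≤ rk T x :=
  (rk_isLUB T hx).1 ⟨0, ⟨le_rfl, hx⟩, map_zero _⟩

theorem le_rk (T : orderBoundedOperators E F) {x : E} (hx : 0 ≤ x) : T.1 x ≤ rk T x :=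
  (rk_isLUB T hx).1 ⟨x, ⟨hx, le_rfl⟩, rfl⟩

theorem rk_add (T : orderBoundedOperators E F) {x y : E} (hx : 0 ≤ x) (hy : 0 ≤ y) :
    rk T (x + y) = rk T x + rk T y := by
  have h : Set.Icc 0 (x + y) = Set.Icc 0 x + Set.Icc 0 y := by
    ext z
    rw [Set.mem_add]
    constructor
    · rintro ⟨h₁, h₂⟩
      refine ⟨z ⊓ x, ⟨le_inf h₁ hx, inf_le_right⟩, z - z ⊓ x, ⟨sub_nonneg.2 inf_le_left, ?_⟩,
        by abel⟩
      rw [sub_le_iff_le_add, add_inf]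
      exact le_inf (le_add_of_nonneg_left hy) (by rwa [add_comm])
    · rintro ⟨a, ha, b, hb, rfl⟩
      exact ⟨add_nonneg ha.1 hb.1, add_le_add ha.2 hb.2⟩
  unfold rk
  rw [h, Set.image_add, csSup_add ((Set.nonempty_Icc.2 hx).image _)
    (T.2 _ bddBelow_Icc bddAbove_Icc).2 ((Set.nonempty_Icc.2 hy).image _)
    (T.2 _ bddBelow_Icc bddAbove_Icc).2]

theorem rk_smul (T : orderBoundedOperators E F) {c : ℝ} (hc : 0 ≤ c) {x : E} (hx : 0 ≤ x) :
    rk T (c • x) = c • rk T x := by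
  have key : ∀ {c : ℝ}, 0 < c → ∀ {x : E}, 0 ≤ x → c • rk T x ≤ rk T (c • x) := by
    intro c hc x hx
    rw [← le_inv_smul_iff_of_pos hc]
    refine (rk_isLUB T hx).2 ?_
    rintro _ ⟨y, hy, rfl⟩
    rw [le_inv_smul_iff_of_pos hc, ← map_smul]
    exact (rk_isLUB T (smul_nonneg hc.le hx)).1
      ⟨c • y, ⟨smul_nonneg hc.le hy.1, smul_le_smul_of_nonneg_left hy.2 hc.le⟩, rfl⟩
  rcases hc.eq_or_lt with rfl | hc
  · have h := rk_add T (le_refl (0 : E)) (le_refl (0 : E))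
    rw [add_zero] at h
    rw [zero_smul, zero_smul]
    exact left_eq_add.1 h
  · refine le_antisymm ?_ (key hc hx)
    have h := key (inv_pos.2 hc) (smul_nonneg hc.le hx)
    rwa [inv_smul_smul₀ hc.ne', inv_smul_le_iff_of_pos hc] at h

theorem rk_sub_eq (T : orderBoundedOperators E F) {a b c d : E} (ha : 0 ≤ a) (hb : 0 ≤ b)
    (hc : 0 ≤ c) (hd : 0 ≤ d) (h : a - b = c - d) : rk T a - rk T b = rk T c - rk T d := by
  rw [sub_eq_sub_iff_add_eq_add] at h ⊢
  rw [← rk_add T ha hd, ← rk_add T hc hb, h]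

/-- The linear extension of `rk T` from the positive cone to the whole space. -/
noncomputable def posLinear (T : orderBoundedOperators E F) : E →ₗ[ℝ] F where
  toFun x := rk T x⁺ - rk T x⁻
  map_add' x y := by
    rw [rk_sub_eq T (c := x⁺ + y⁺) (d := x⁻ + y⁻) (posPart_nonneg _) (negPart_nonneg _)
      (add_nonneg (posPart_nonneg _) (posPart_nonneg _))
      (add_nonneg (negPart_nonneg _) (negPart_nonneg _))
      (by rw [posPart_sub_negPart, add_sub_add_comm, posPart_sub_negPart, posPart_sub_negPart]),
      rk_add T (posPart_nonneg _) (posPart_nonneg _), rk_add T (negPart_nonneg _) (negPart_nonneg _)]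
    abel
  map_smul' r x := by
    simp only [RingHom.id_apply]
    rcases le_total 0 r with hr | hr
    · rw [rk_sub_eq T (c := r • x⁺) (d := r • x⁻) (posPart_nonneg _) (negPart_nonneg _)
        (smul_nonneg hr (posPart_nonneg _)) (smul_nonneg hr (negPart_nonneg _))
        (by rw [posPart_sub_negPart, ← smul_sub, posPart_sub_negPart]),
        rk_smul T hr (posPart_nonneg _), rk_smul T hr (negPart_nonneg _), smul_sub]
    · have hr' : 0 ≤ -r := neg_nonneg.2 hr
      rw [rk_sub_eq T (c := (-r) • x⁻) (d := (-r) • x⁺) (posPart_nonneg _) (negPart_nonneg _)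
        (smul_nonneg hr' (negPart_nonneg _)) (smul_nonneg hr' (posPart_nonneg _))
        (by rw [posPart_sub_negPart, ← smul_sub, neg_smul, ← smul_neg, neg_sub,
          posPart_sub_negPart]),
        rk_smul T hr' (posPart_nonneg _), rk_smul T hr' (negPart_nonneg _), ← smul_sub, neg_smul,
        ← smul_neg, neg_sub]

theorem posLinear_apply (T : orderBoundedOperators E F) (x : E) :
    posLinear T x = rk T x⁺ - rk T x⁻ := rfl

theorem posLinear_of_nonneg (T : orderBoundedOperators E F) {x : E} (hx : 0 ≤ x) :
    posLinear T x = rk T x := by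
  have h0 : rk T (0 : E) = 0 := by simpa using rk_smul T le_rfl (le_refl (0 : E))
  have h : rk T x⁺ - rk T x⁻ = rk T x - rk T 0 :=
    rk_sub_eq T (posPart_nonneg _) (negPart_nonneg _) hx le_rfl
      (by rw [posPart_sub_negPart, sub_zero])
  rw [posLinear_apply, h, h0, sub_zero]

theorem posLinear_mono (T : orderBoundedOperators E F) : Monotone (posLinear T) := by
  intro x y h
  rw [← sub_nonneg, ← map_sub, posLinear_of_nonneg T (sub_nonneg.2 h)]
  exact rk_nonneg T (sub_nonneg.2 h)

/-- The positive part of an order bounded operator. -/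
noncomputable def posOp (T : orderBoundedOperators E F) : orderBoundedOperators E F :=
  ⟨posLinear T, fun _ h₁ h₂ =>
    ⟨(posLinear_mono T).map_bddBelow h₁, (posLinear_mono T).map_bddAbove h₂⟩⟩

theorem posOp_apply (T : orderBoundedOperators E F) {x : E} (hx : 0 ≤ x) :
    (posOp T).1 x = rk T x := posLinear_of_nonneg T hx

theorem posOp_le {T R : orderBoundedOperators E F} (h0 : 0 ≤ R) (h : T ≤ R) : posOp T ≤ R := by
  intro x hx
  rw [posOp_apply T hx]
  refine (rk_isLUB T hx).2 ?_
  rintro _ ⟨y, hy, rfl⟩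
  refine (h y hy.1).trans ?_
  have : (0 : F) ≤ R.1 (x - y) := h0 (x - y) (sub_nonneg.2 hy.2)
  rw [map_sub] at this
  exact sub_nonneg.1 this

/-- For a Dedekind complete codomain, the order bounded operators form a lattice in the operator
order. -/
noncomputable instance instLatticeOrderBounded : Lattice (orderBoundedOperators E F) where
  sup T S := T + posOp (S - T)
  le_sup_left T S x hx := by
    have := rk_nonneg (S - T) hx
    rw [← posOp_apply _ hx] at this
    exact le_add_of_nonneg_right this
  le_sup_right T S x hx := by
    have := le_rk (S - T) hx
    rw [← posOp_apply _ hx] at this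
    exact sub_le_iff_le_add'.1 this
  sup_le T S R h₁ h₂ x hx := by
    have : posOp (S - T) ≤ R - T :=
      posOp_le (fun y hy => sub_nonneg.2 (h₁ y hy)) (fun y hy => sub_le_sub_right (h₂ y hy) _)
    exact le_sub_iff_add_le'.1 (this x hx)
  inf T S := T - posOp (T - S)
  inf_le_left T S x hx := by
    have := rk_nonneg (T - S) hx
    rw [← posOp_apply _ hx] at this
    exact sub_le_self _ this
  inf_le_right T S x hx := by
    have := le_rk (T - S) hx
    rw [← posOp_apply _ hx] at this
    exact sub_le_comm.1 this
  le_inf R T S h₁ h₂ x hx := by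
    have : posOp (T - S) ≤ T - R :=
      posOp_le (fun y hy => sub_nonneg.2 (h₁ y hy)) (fun y hy => sub_le_sub_left (h₂ y hy) _)
    exact le_sub_comm.1 (this x hx)

theorem sup_def (T S : orderBoundedOperators E F) : T ⊔ S = T + posOp (S - T) := rfl

theorem inf_def (T S : orderBoundedOperators E F) : T ⊓ S = T - posOp (T - S) := rfl

end RieszKantorovich

/-! ### Orthomorphisms -/

section Orthomorphisms

/-- The orthomorphisms of `E`: the order bounded operators that map every band into itself. -/
def orthomorphisms (E : Type u) [Lattice E] [AddCommGroup E] [IsOrderedAddMonoid E] [Module ℝ E]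
    [IsOrderedModule ℝ E] : Submodule ℝ (orderBoundedOperators E E) where
  carrier := {T | ∀ B : Submodule ℝ E, IsBand B → ∀ x ∈ B, T.1 x ∈ B}
  zero_mem' := fun B _ _ _ => B.zero_mem
  add_mem' := fun hT hS B hB x hx => B.add_mem (hT B hB x hx) (hS B hB x hx)
  smul_mem' := fun r _ hT B hB x hx => B.smul_mem r (hT B hB x hx)

variable {E : Type u} [ConditionallyCompleteLattice E] [AddCommGroup E] [IsOrderedAddMonoid E]
  [Module ℝ E] [IsOrderedModule ℝ E]

theorem posOp_mem_orthomorphisms {T : orderBoundedOperators E E} (hT : T ∈ orthomorphisms E) :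
    posOp T ∈ orthomorphisms E := by
  intro B hB x hx
  have key : ∀ z : E, 0 ≤ z → |z| ≤ |x| → rk T z ∈ B := by
    intro z hz hzx
    refine hB.mem_of_isLUB _ _ ?_ (rk_isLUB T hz)
    rintro _ ⟨y, hy, rfl⟩
    refine hT B hB y (hB.solid hx ?_)
    refine le_trans ?_ hzx
    rw [abs_of_nonneg hy.1, abs_of_nonneg hz]
    exact hy.2
  refine B.sub_mem (key _ (posPart_nonneg x) ?_) (key _ (negPart_nonneg x) ?_)
  · rw [abs_of_nonneg (posPart_nonneg x), ← posPart_add_negPart x]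
    exact le_add_of_nonneg_right (negPart_nonneg x)
  · rw [abs_of_nonneg (negPart_nonneg x), ← posPart_add_negPart x]
    exact le_add_of_nonneg_left (posPart_nonneg x)

/-- The orthomorphisms form a sublattice of the order bounded operators. -/
noncomputable instance instLatticeOrthomorphisms : Lattice (orthomorphisms E) :=
  Subtype.lattice
    (fun _ _ hT hS => (orthomorphisms E).add_mem hT
      (posOp_mem_orthomorphisms ((orthomorphisms E).sub_mem hS hT)))
    (fun _ _ hT hS => (orthomorphisms E).sub_mem hT
      (posOp_mem_orthomorphisms ((orthomorphisms E).sub_mem hT hS)))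

end Orthomorphisms

end VectorLattice

open VectorLattice

namespace VectorLattice

universe u v

/-! ### Inequalities in vector lattices -/

section LatticeFacts

/-! Uo convergence to `0` says that, for each `y ≥ 0`, the eventual upper bounds of `|f a| ⊓ y` have
infimum `0`. `UOTendsto.nonpos` and `uoTendsto_zero_of` express this without auxiliary nets: an
element below all these bounds must be `≤ 0`.

The operator side rests on locality: for an orthomorphism `T` and `x, y ≥ 0`, the elements `(T x)⁺`
and `(T y)⁻` are disjoint (`orthomorphism_posPart_inf_negPart`). Hence the Riesz-Kantorovich
supremum for `T⁺` is `(T x)⁺`, finite lattice operations on orthomorphisms are pointwise on the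
positive cone, `|T x| = |T| |x|`, and bounded suprema of positive orthomorphisms are pointwise as
well. Moreover, operators between `0` and an orthomorphism are orthomorphisms.

The implications 1 → 4 → 2 → 1 and 3 ↔ 4 suffice. For 1 → 4, test against the identity: the eventual
bounds of `|T a| ⊓ I` have infimum `0`, also pointwise, so an element below all eventual bounds of
`|T a x| ⊓ y` is disjoint from `x`, hence from every `T a x`, hence zero. For 4 → 2, tail suprema of
`|T a| ⊓ Y` are pointwise, which reduces the claim to `E`. For 2 → 1, a bound `u` may be replaced by
the orthomorphism `u ⊓ Y`. For 3 → 4, `|x|` is split into a part below `(n + 1) • |s|` and a part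
disjoint from `((n + 1) • |s| - |x|)⁺`; letting `n` grow shows that the offending element is
disjoint from each `s`, hence zero. -/

theorem abs_smul_le {E : Type u} [Lattice E] [AddCommGroup E]
    [Module ℝ E] [IsOrderedModule ℝ E] (r : ℝ) (x : E) : |r • x| ≤ |r| • |x| := by
  have key : ∀ y : E, y ≤ |x| → -y ≤ |x| → r • y ≤ |r| • |x| := by
    intro y h1 h2
    rcases le_total 0 r with hr | hr
    · rw [abs_of_nonneg hr]
      exact smul_le_smul_of_nonneg_left h1 hr
    · rw [abs_of_nonpos hr, ← neg_smul_neg]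
      exact smul_le_smul_of_nonneg_left h2 (neg_nonneg.2 hr)
  refine abs_le'.2 ⟨key x (le_abs_self x) (neg_le_abs x), ?_⟩
  rw [← smul_neg]
  exact key (-x) (neg_le_abs x) (by rw [neg_neg]; exact le_abs_self x)

variable {E : Type u} [Lattice E] [AddCommGroup E] [IsOrderedAddMonoid E]

/-- Since `d ⊓ v + d ⊔ v = d + v`, the hypothesis bounds `d` by `u + x ⊔ v - v`, which no longer
depends on `d`. This is infinite distributivity. -/
theorem inf_le_of_isLUB {D : Set E} {x v u : E} (hx : IsLUB D x) (h : ∀ d ∈ D, d ⊓ v ≤ u) :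
    x ⊓ v ≤ u := by
  have h1 : x ≤ u + x ⊔ v - v := by
    refine hx.2 fun d hd => ?_
    rw [le_sub_iff_add_le, ← inf_add_sup d v]
    exact add_le_add (h d hd) (sup_le_sup_right (hx.1 hd) _)
  rw [le_sub_iff_add_le, ← inf_add_sup x v] at h1
  exact le_of_add_le_add_right h1

theorem sup_inf_le {a b v u : E} (ha : a ⊓ v ≤ u) (hb : b ⊓ v ≤ u) : (a ⊔ b) ⊓ v ≤ u := by
  refine inf_le_of_isLUB (D := {a, b}) isLUB_pair ?_
  rintro d (rfl | rfl) <;> assumption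

theorem add_inf_le {a b v : E} (ha : 0 ≤ a) (hb : 0 ≤ b) (hv : 0 ≤ v) :
    (a + b) ⊓ v ≤ a ⊓ v + b ⊓ v := by
  rw [add_inf, inf_add, inf_add]
  exact le_inf (le_inf inf_le_left (inf_le_right.trans (le_add_of_nonneg_right hb)))
    (le_inf (inf_le_right.trans (le_add_of_nonneg_left ha))
      (inf_le_right.trans (le_add_of_nonneg_left hv)))

theorem nsmul_inf_le {a v : E} (ha : 0 ≤ a) (hv : 0 ≤ v) (n : ℕ) : (n • a) ⊓ v ≤ n • (a ⊓ v) := by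
  induction n with
  | zero => simp
  | succ n ih =>
    rw [succ_nsmul, succ_nsmul]
    exact (add_inf_le (nsmul_nonneg ha n) ha hv).trans (add_le_add_left ih _)

theorem abs_posPart (a : E) : |a⁺| = a⁺ := abs_of_nonneg (posPart_nonneg a)

theorem abs_negPart (a : E) : |a⁻| = a⁻ := abs_of_nonneg (negPart_nonneg a)

theorem posPart_le_abs (a : E) : a⁺ ≤ |a| :=
  posPart_add_negPart a ▸ le_add_of_nonneg_right (negPart_nonneg a)

theorem negPart_le_abs (a : E) : a⁻ ≤ |a| :=
  posPart_add_negPart a ▸ le_add_of_nonneg_left (posPart_nonneg a)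

theorem smul_inf_eq_zero [Module ℝ E] [IsOrderedModule ℝ E] {c : ℝ} (hc : 0 ≤ c) {a b : E}
    (ha : 0 ≤ a) (hb : 0 ≤ b) (h : a ⊓ b = 0) : (c • a) ⊓ b = 0 := by
  refine le_antisymm ?_ (le_inf (smul_nonneg hc ha) hb)
  obtain ⟨n, hn⟩ := exists_nat_ge c
  have h1 : c • a ≤ n • a := by
    rw [← Nat.cast_smul_eq_nsmul ℝ]
    exact smul_le_smul_of_nonneg_right hn ha
  refine (inf_le_inf_right b h1).trans ((nsmul_inf_le ha hb n).trans ?_)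
  rw [h, smul_zero]

end LatticeFacts

/-! ### Disjoint complements as bands -/

section DisjointComplement

variable {E : Type u} [Lattice E] [AddCommGroup E] [IsOrderedAddMonoid E] [Module ℝ E]
  [IsOrderedModule ℝ E]

/-- The elements that are disjoint from `v`. -/
def disjointComplement (v : E) : Submodule ℝ E where
  carrier := {x | |x| ⊓ |v| = 0}
  zero_mem' := by simp
  add_mem' := by
    intro x y hx hy
    refine le_antisymm ?_ (le_inf (abs_nonneg _) (abs_nonneg _))
    refine (inf_le_inf_right _ (abs_add_le x y)).trans ?_
    refine (add_inf_le (abs_nonneg _) (abs_nonneg _) (abs_nonneg _)).trans ?_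
    rw [hx, hy, add_zero]
  smul_mem' := by
    intro c x hx
    refine le_antisymm ?_ (le_inf (abs_nonneg _) (abs_nonneg _))
    refine (inf_le_inf_right _ (abs_smul_le c x)).trans (le_of_eq ?_)
    exact smul_inf_eq_zero (abs_nonneg c) (abs_nonneg x) (abs_nonneg v) hx

theorem mem_disjointComplement {x v : E} : x ∈ disjointComplement v ↔ |x| ⊓ |v| = 0 := Iff.rfl

theorem mem_disjointComplement_comm {x v : E} :
    x ∈ disjointComplement v ↔ v ∈ disjointComplement x := by
  rw [mem_disjointComplement, mem_disjointComplement, inf_comm]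

theorem mem_disjointComplement_of_abs_le {x y v : E} (hx : x ∈ disjointComplement v)
    (h : |y| ≤ |x|) : y ∈ disjointComplement v :=
  le_antisymm ((inf_le_inf_right _ h).trans hx.le) (le_inf (abs_nonneg _) (abs_nonneg _))

theorem abs_mem_disjointComplement {x v : E} (hx : x ∈ disjointComplement v) :
    |x| ∈ disjointComplement v :=
  mem_disjointComplement_of_abs_le hx (abs_abs x).le

theorem eq_zero_of_mem_disjointComplement_of_abs_le {x v : E} (hx : x ∈ disjointComplement v)
    (h : |v| ≤ |x|) : v = 0 := by
  have h1 : |v| = 0 := by rw [← hx, inf_eq_right.2 h]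
  exact le_antisymm (h1 ▸ le_abs_self v) (neg_nonpos.1 (h1 ▸ neg_le_abs v))

theorem negPart_mem_disjointComplement_posPart (x : E) : x⁻ ∈ disjointComplement x⁺ := by
  rw [mem_disjointComplement, abs_posPart, abs_negPart, inf_comm, posPart_inf_negPart_eq_zero]

theorem isBand_disjointComplement (v : E) : IsBand (disjointComplement v) where
  solid _ hx _ h := mem_disjointComplement_of_abs_le hx h
  mem_of_isLUB D x hD hx := by
    rcases D.eq_empty_or_nonempty with rfl | ⟨d, hd⟩
    -- A supremum of the empty set is a least element; `x ≤ 0` and `x ≤ x + x` then force `x = 0`.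
    · have h : ∀ y, x ≤ y := fun y => hx.2 (by simp [upperBounds])
      have h0 : x = 0 := le_antisymm (h 0) (by simpa using h (x + x))
      rw [h0]
      exact Submodule.zero_mem _
    · refine le_antisymm ?_ (le_inf (abs_nonneg _) (abs_nonneg _))
      refine sup_inf_le (inf_le_of_isLUB hx fun d hd => ?_) ?_
      · exact (inf_le_inf_right _ (le_abs_self d)).trans (hD hd).le
      · exact (inf_le_inf_right _ ((neg_le_neg (hx.1 hd)).trans (neg_le_abs d))).trans (hD hd).le

/-- The disjoint complement of `z` is a band containing `S`, so it contains `z` itself. -/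
theorem eq_zero_of_disjoint_of_bandGenerated_eq_top {S : Set E} (hS : bandGenerated S = ⊤) {z : E}
    (h : ∀ s ∈ S, s ∈ disjointComplement z) : z = 0 := by
  have h1 : z ∈ bandGenerated S := hS ▸ Submodule.mem_top
  exact eq_zero_of_mem_disjointComplement_of_abs_le
    (Submodule.mem_sInf.1 h1 _ ⟨isBand_disjointComplement z, h⟩) le_rfl

end DisjointComplement

/-! ### The Archimedean property -/

section Archimedean

/-- If `s` is the supremum of the multiples of `w`, then adding `w` to a multiple gives another one,
so `s - w` is still an upper bound. -/
theorem nonpos_of_nsmul_le {E : Type u} [ConditionallyCompleteLattice E] [AddCommGroup E]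
    [IsOrderedAddMonoid E] {w g : E} (h : ∀ n : ℕ, (n + 1) • w ≤ g) : w ≤ 0 := by
  have hs : IsLUB (Set.range fun n : ℕ => (n + 1) • w) _ :=
    isLUB_csSup (Set.range_nonempty _) ⟨g, by rintro _ ⟨n, rfl⟩; exact h n⟩
  set s := sSup (Set.range fun n : ℕ => (n + 1) • w)
  have h1 : s ≤ s - w := by
    refine hs.2 ?_
    rintro _ ⟨n, rfl⟩
    have := hs.1 ⟨n + 1, rfl⟩
    rw [le_sub_iff_add_le]
    exact (succ_nsmul w (n + 1)).symm.trans_le this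
  simpa using h1

end Archimedean

/-! ### Uo convergence through eventual upper bounds -/

section Convergence

variable {X : Type u} [Lattice X] [AddCommGroup X] [IsOrderedAddMonoid X]
  {ι : Type v} [Preorder ι]

theorem UOTendsto.nonpos {f : ι → X} (h : UOTendsto f 0) {y z : X} (hy : 0 ≤ y)
    (hz : ∀ u, (∃ a₀, ∀ a, a₀ ≤ a → |f a| ⊓ y ≤ u) → z ≤ u) : z ≤ 0 := by
  obtain ⟨B, _, _, _, w, -, hw, hb⟩ := h y hy
  refine hw.2 ?_
  rintro _ ⟨b, rfl⟩
  refine hz _ ?_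
  obtain ⟨a₀, ha⟩ := hb b
  refine ⟨a₀, fun a h => ?_⟩
  simpa [abs_of_nonneg (le_inf (abs_nonneg (f a)) hy)] using ha a h

/-- The eventual upper bounds, indexed by themselves in reversed order, form the required decreasing
net; directedness of `ι` makes them closed under `⊓`. -/
theorem uoTendsto_zero_of [IsDirectedOrder ι] [Nonempty ι] {f : ι → X}
    (h : ∀ y z : X, 0 ≤ y → 0 ≤ z →
      (∀ u, (∃ a₀, ∀ a, a₀ ≤ a → |f a| ⊓ y ≤ u) → z ≤ u) → z ≤ 0) : UOTendsto f 0 := by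
  intro y hy
  let U : Set X := {u | ∃ a₀, ∀ a, a₀ ≤ a → |f a| ⊓ y ≤ u}
  have hU : ∀ u ∈ U, 0 ≤ u := by
    rintro u ⟨a₀, ha⟩
    exact (le_inf (abs_nonneg _) hy).trans (ha a₀ le_rfl)
  have hdir : IsDirectedOrder (Uᵒᵈ) := by
    refine ⟨fun b c => ?_⟩
    obtain ⟨a₁, h₁⟩ := (OrderDual.ofDual b).2
    obtain ⟨a₂, h₂⟩ := (OrderDual.ofDual c).2
    obtain ⟨a₃, h₁₃, h₂₃⟩ := exists_ge_ge a₁ a₂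
    refine ⟨OrderDual.toDual ⟨(OrderDual.ofDual b).1 ⊓ (OrderDual.ofDual c).1, a₃, fun a ha =>
      le_inf (h₁ a (h₁₃.trans ha)) (h₂ a (h₂₃.trans ha))⟩, ?_, ?_⟩
    · exact Subtype.coe_le_coe.1 (inf_le_left (a := (OrderDual.ofDual b).1))
    · exact Subtype.coe_le_coe.1 (inf_le_right (b := (OrderDual.ofDual c).1))
  have hne : Nonempty (Uᵒᵈ) := by
    obtain ⟨a₀⟩ := ‹Nonempty ι›
    exact ⟨OrderDual.toDual ⟨y, a₀, fun _ _ => inf_le_right⟩⟩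
  refine ⟨Uᵒᵈ, inferInstance, hdir, hne, fun b => (OrderDual.ofDual b).1, fun b c hbc => hbc,
    ⟨?_, fun z hz => ?_⟩, fun b => ?_⟩
  · rintro _ ⟨b, rfl⟩
    exact hU _ (OrderDual.ofDual b).2
  -- All bounds are nonnegative, so `z⁺` is a lower bound too; this is why testing `z ≥ 0` suffices.
  · refine (le_posPart z).trans (h y z⁺ hy (posPart_nonneg z) fun u hu => ?_)
    exact sup_le_iff.2 ⟨hz ⟨OrderDual.toDual ⟨u, hu⟩, rfl⟩, hU u hu⟩
  · obtain ⟨a₀, ha⟩ := (OrderDual.ofDual b).2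
    refine ⟨a₀, fun a h => ?_⟩
    simpa [abs_of_nonneg (le_inf (abs_nonneg (f a)) hy)] using ha a h

end Convergence

/-! ### Localising tail bounds -/

section Tails

variable {E : Type u} [ConditionallyCompleteLattice E] [AddCommGroup E] [IsOrderedAddMonoid E]
  {ι : Type v} [Preorder ι]

/-- The supremum of a tail is an eventual bound, hence lies above `z`, and meeting with `v`
distributes over it. So tails need only be estimated below `v`. -/
theorem inf_le_of_tail_inf_le {f : ι → E} {y z v u : E}
    (hz : ∀ u, (∃ a₀, ∀ a, a₀ ≤ a → |f a| ⊓ y ≤ u) → z ≤ u)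
    (h : ∃ a₀, ∀ a, a₀ ≤ a → |f a| ⊓ y ⊓ v ≤ u) : z ⊓ v ≤ u := by
  obtain ⟨a₀, ha⟩ := h
  have hs : IsLUB ((fun a => |f a| ⊓ y) '' Set.Ici a₀) _ :=
    isLUB_csSup (Set.nonempty_Ici.image _) ⟨y, by rintro _ ⟨a, -, rfl⟩; exact inf_le_right⟩
  have h1 : z ≤ sSup ((fun a => |f a| ⊓ y) '' Set.Ici a₀) :=
    hz _ ⟨a₀, fun a ha => hs.1 ⟨a, ha, rfl⟩⟩
  refine (inf_le_inf_right v h1).trans (inf_le_of_isLUB hs ?_)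
  rintro _ ⟨a, h, rfl⟩
  exact ha a h

end Tails

/-! ### Order bounded operators as an ordered group -/

section OperatorGroup

variable {E : Type u} [Lattice E] [AddCommGroup E] [Module ℝ E]
  {F : Type v} [Lattice F] [AddCommGroup F] [IsOrderedAddMonoid F] [Module ℝ F]
  [IsOrderedModule ℝ F]

theorem exists_abs_le (T : orderBoundedOperators E F) (x : E) :
    ∃ g : F, 0 ≤ g ∧ ∀ z, 0 ≤ z → z ≤ x → |T.1 z| ≤ g := by
  obtain ⟨⟨l, hl⟩, ⟨m, hm⟩⟩ := T.2 (Set.Icc 0 x) bddBelow_Icc bddAbove_Icc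
  refine ⟨|m| + |l|, add_nonneg (abs_nonneg _) (abs_nonneg _), fun z h1 h2 => abs_le'.2 ⟨?_, ?_⟩⟩
  · exact (hm ⟨z, ⟨h1, h2⟩, rfl⟩).trans
      ((le_abs_self m).trans (le_add_of_nonneg_right (abs_nonneg _)))
  · exact (neg_le_neg (hl ⟨z, ⟨h1, h2⟩, rfl⟩)).trans
      ((neg_le_abs l).trans (le_add_of_nonneg_left (abs_nonneg _)))

instance instIsOrderedAddMonoidOrderBounded [IsOrderedAddMonoid E] :
    IsOrderedAddMonoid (orderBoundedOperators E F) where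
  add_le_add_left _ _ h S x hx := add_le_add_left (h x hx) (S.1 x)

end OperatorGroup

/-! ### Locality of orthomorphisms and pointwise lattice operations -/

section Locality

theorem abs_add_eq_abs_sub_of_disjoint {E : Type u} [Lattice E] [AddCommGroup E]
    [IsOrderedAddMonoid E] {a b : E} (h : |a| ⊓ |b| = 0) : |a + b| = |a - b| := by
  have key : ∀ {a b : E}, |a| ⊓ |b| = 0 → |a| ≤ |a - b| := by
    intro a b h
    have h1 : |a| ≤ |a - b| + |b| := by simpa using abs_add_le (a - b) b
    calc |a| ≤ (|a - b| + |b|) ⊓ |a| := le_inf h1 le_rfl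
      _ ≤ |a - b| ⊓ |a| + |b| ⊓ |a| := add_inf_le (abs_nonneg _) (abs_nonneg _) (abs_nonneg _)
      _ ≤ |a - b| := by
        rw [inf_comm |b|, h, add_zero]
        exact inf_le_left
  have key' : ∀ {a b : E}, |a| ⊓ |b| = 0 → |a + b| ≤ |a - b| := by
    intro a b h
    refine (abs_add_le a b).trans ?_
    rw [← inf_add_sup, h, zero_add]
    exact sup_le (key h) (abs_sub_comm a b ▸ key (inf_comm |a| |b| ▸ h))
  refine le_antisymm (key' h) ?_
  have h' := key' (a := a) (b := -b) (by rwa [abs_neg])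
  rwa [← sub_eq_add_neg, sub_neg_eq_add] at h'

variable {E : Type u} [ConditionallyCompleteLattice E] [AddCommGroup E] [IsOrderedAddMonoid E]
  [Module ℝ E] [IsOrderedModule ℝ E]

instance instIsOrderedAddMonoidOrthomorphisms : IsOrderedAddMonoid (orthomorphisms E) where
  add_le_add_left _ _ h S x hx := add_le_add_left (h x hx) (S.1.1 x)

theorem orthomorphism_mem_disjointComplement {T : orderBoundedOperators E E}
    (hT : T ∈ orthomorphisms E) {x v : E} (hx : x ∈ disjointComplement v) :
    T.1 x ∈ disjointComplement v :=
  hT _ (isBand_disjointComplement v) x hx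

/-- One step of the slicing argument: an element which lies below `(T x)⁺` and `(T y)⁻` up to a
small error and is disjoint from `(y - (t + δ) • x)⁺` is disjoint from `(y - t • x)⁺`. -/
theorem slice_step {T : orderBoundedOperators E E} (hT : T ∈ orthomorphisms E) {x y w g : E}
    {δ t : ℝ} (hx : 0 ≤ x) (hδ : 0 ≤ δ) (ht : 0 ≤ t) (hg : 0 ≤ g)
    (hTg : ∀ z, 0 ≤ z → z ≤ δ • x → |T.1 z| ≤ g) (hw : 0 ≤ w) (hwx : w ≤ (T.1 x)⁺)
    (hwy : w ≤ (T.1 y)⁻)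
    (h : (w - g)⁺ ∈ disjointComplement (y - (t + δ) • x)⁺) :
    (w - g)⁺ ∈ disjointComplement (y - t • x)⁺ := by
  set v := (w - g)⁺ with hv
  set a := (y - (t + δ) • x)⁺ with ha
  set b := (y - t • x)⁺ with hb
  have hv0 : 0 ≤ v := posPart_nonneg _
  have ha0 : 0 ≤ a := posPart_nonneg _
  have hb0 : 0 ≤ b := posPart_nonneg _
  have hδx : 0 ≤ δ • x := smul_nonneg hδ hx
  have hab : a ≤ b := posPart_mono (by
    rw [add_smul]
    exact sub_le_sub_left (le_add_of_nonneg_right hδx) _)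
  have hba : b - a ≤ δ • x := by
    rw [sub_le_iff_le_add]
    refine sup_le_iff.2 ⟨?_, add_nonneg hδx ha0⟩
    have : y - (t + δ) • x ≤ a := le_posPart _
    rw [add_smul] at this
    calc y - t • x = δ • x + (y - (t • x + δ • x)) := by abel
      _ ≤ _ := add_le_add_right this _
  have hvw : v ≤ w := sup_le_iff.2 ⟨sub_le_self _ hg, hw⟩
  have hvb0 : 0 ≤ v ⊓ b := le_inf hv0 hb0
  have h1 : T.1 a ∈ disjointComplement (v ⊓ b) := by
    refine orthomorphism_mem_disjointComplement hT (mem_disjointComplement_comm.1 ?_)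
    refine mem_disjointComplement_of_abs_le h ?_
    rw [abs_of_nonneg hvb0, abs_of_nonneg hv0]
    exact inf_le_left
  have h2 : T.1 (y - t • x)⁻ ∈ disjointComplement (v ⊓ b) := by
    refine orthomorphism_mem_disjointComplement hT (mem_disjointComplement_comm.1 ?_)
    refine mem_disjointComplement_of_abs_le
      (mem_disjointComplement_comm.1 (negPart_mem_disjointComplement_posPart _)) ?_
    rw [abs_of_nonneg hvb0, abs_of_nonneg hb0]
    exact inf_le_right
  have h3 : (T.1 x)⁻ ∈ disjointComplement (v ⊓ b) := by
    refine mem_disjointComplement_comm.1 (mem_disjointComplement_of_abs_le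
      (mem_disjointComplement_comm.1 (negPart_mem_disjointComplement_posPart _)) ?_)
    rw [abs_of_nonneg hvb0, abs_posPart]
    exact inf_le_left.trans (hvw.trans hwx)
  have hG := Submodule.add_mem _ (Submodule.add_mem _ (abs_mem_disjointComplement h1)
    (abs_mem_disjointComplement h2)) (Submodule.smul_mem _ t h3)
  have hG0 : 0 ≤ |T.1 a| + |T.1 (y - t • x)⁻| + t • (T.1 x)⁻ :=
    add_nonneg (add_nonneg (abs_nonneg _) (abs_nonneg _)) (smul_nonneg ht (negPart_nonneg _))
  have hle : v ⊓ b ≤ |T.1 a| + |T.1 (y - t • x)⁻| + t • (T.1 x)⁻ := by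
    refine inf_le_left.trans (sup_le_iff.2 ⟨?_, hG0⟩)
    rw [sub_le_iff_le_add]
    refine hwy.trans (sup_le_iff.2 ⟨?_, add_nonneg hG0 hg⟩)
    -- The first three terms are dominated by elements disjoint from `v ⊓ b`; the last is at most
    -- `g` because `0 ≤ b - a ≤ δ • x`.
    have e : -T.1 y = -T.1 a + T.1 (y - t • x)⁻ + t • (-T.1 x) + -T.1 (b - a) := by
      have : y = b - (y - t • x)⁻ + t • x := by rw [hb, posPart_sub_negPart]; abel
      conv_lhs => rw [this]
      simp only [map_add, map_sub, map_smul, smul_neg]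
      abel
    rw [e]
    exact add_le_add (add_le_add (add_le_add (neg_le_abs _) (le_abs_self _))
      (smul_le_smul_of_nonneg_left (neg_le_negPart _) ht))
      ((neg_le_abs _).trans (hTg _ (sub_nonneg.2 hab) hba))
  have h0 : v ⊓ b = 0 := by
    refine eq_zero_of_mem_disjointComplement_of_abs_le hG ?_
    rwa [abs_of_nonneg hvb0, abs_of_nonneg hG0]
  rw [mem_disjointComplement, abs_of_nonneg hv0, abs_of_nonneg hb0, h0]

/-- Descend from `t = 1`, where `(y - x)⁺ = 0`, to `t = 0` in `n + 1` slices of width `1 / (n + 1)`.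
Each slice costs the same error `δ • g`, which does not accumulate. At the end `(w - δ • g)⁺` is
disjoint from `y`, hence from `T y`, although it lies below `(T y)⁻`. So `w ≤ δ • g` for every `n`.
-/
theorem orthomorphism_posPart_inf_negPart_of_le {T : orderBoundedOperators E E}
    (hT : T ∈ orthomorphisms E) {x y : E} (hy : 0 ≤ y) (hyx : y ≤ x) :
    (T.1 x)⁺ ⊓ (T.1 y)⁻ = 0 := by
  have hx : 0 ≤ x := hy.trans hyx
  obtain ⟨g, hg, hTg⟩ := exists_abs_le T x
  set w := (T.1 x)⁺ ⊓ (T.1 y)⁻ with hw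
  have hw0 : 0 ≤ w := le_inf (posPart_nonneg _) (negPart_nonneg _)
  refine le_antisymm (nonpos_of_nsmul_le (g := g) fun n => ?_) hw0
  set δ : ℝ := ((n : ℝ) + 1)⁻¹ with hδ
  have hn : (0 : ℝ) < (n : ℝ) + 1 := by positivity
  have hδ0 : 0 < δ := inv_pos.2 hn
  have hTδ : ∀ z, 0 ≤ z → z ≤ δ • x → |T.1 z| ≤ δ • g := by
    intro z h1 h2
    have h3 := hTg (((n : ℝ) + 1) • z) (smul_nonneg hn.le h1) (by
      rw [← le_inv_smul_iff_of_pos hn]; exact h2)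
    have h4 : T.1 z = δ • T.1 (((n : ℝ) + 1) • z) := by
      rw [map_smul, hδ, inv_smul_smul₀ hn.ne']
    rw [h4]
    refine (abs_smul_le _ _).trans ?_
    rw [abs_of_pos hδ0]
    exact smul_le_smul_of_nonneg_left h3 hδ0.le
  have key : ∀ k : ℕ, k ≤ n + 1 →
      (w - δ • g)⁺ ∈ disjointComplement (y - (1 - k * δ) • x)⁺ := by
    intro k
    induction k with
    | zero =>
      intro _
      have h0 : (y - (1 - ((0 : ℕ) : ℝ) * δ) • x)⁺ = 0 := by
        rw [posPart_eq_zero]; simpa using hyx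
      rw [h0]
      simp [mem_disjointComplement]
    | succ k ih =>
      intro hk
      refine slice_step hT hx hδ0.le ?_ (smul_nonneg hδ0.le hg) hTδ hw0 inf_le_left inf_le_right ?_
      · rw [sub_nonneg, hδ, ← div_eq_mul_inv, div_le_one hn]
        exact_mod_cast hk
      · have := ih (by omega)
        have e : (1 - ((k + 1 : ℕ) : ℝ) * δ) + δ = 1 - k * δ := by push_cast; ring
        rwa [e]
  have h1 := key (n + 1) le_rfl
  have e : (1 - ((n + 1 : ℕ) : ℝ) * δ) = 0 := by
    rw [hδ]; push_cast; rw [mul_inv_cancel₀ hn.ne', sub_self]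
  rw [e, zero_smul, sub_zero, posPart_of_nonneg hy, mem_disjointComplement_comm] at h1
  have h2 : (w - δ • g)⁺ = 0 := by
    refine eq_zero_of_mem_disjointComplement_of_abs_le
      (orthomorphism_mem_disjointComplement hT h1) ?_
    rw [abs_posPart]
    refine (sup_le_iff.2 ⟨?_, hw0⟩ : (w - δ • g)⁺ ≤ w).trans
      (inf_le_right.trans (negPart_le_abs _))
    exact sub_le_self _ (smul_nonneg hδ0.le hg)
  rw [posPart_eq_zero, sub_nonpos, le_inv_smul_iff_of_pos hn] at h2
  rw [← Nat.cast_smul_eq_nsmul ℝ]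
  push_cast
  exact h2

/-- The values of an orthomorphism on the positive cone do not change sign locally. -/
theorem orthomorphism_posPart_inf_negPart {T : orderBoundedOperators E E}
    (hT : T ∈ orthomorphisms E) {x y : E} (hx : 0 ≤ x) (hy : 0 ≤ y) :
    (T.1 x)⁺ ⊓ (T.1 y)⁻ = 0 := by
  set w := (T.1 x)⁺ ⊓ (T.1 y)⁻ with hw
  have hw0 : 0 ≤ w := le_inf (posPart_nonneg _) (negPart_nonneg _)
  have key : ∀ z, x ≤ z → y ≤ z → T.1 z ∈ disjointComplement w := by
    intro z h1 h2
    rw [← posPart_sub_negPart (T.1 z)]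
    refine Submodule.sub_mem _ ?_ ?_
    · refine le_antisymm ?_ (le_inf (abs_nonneg _) (abs_nonneg _))
      rw [abs_posPart, abs_of_nonneg hw0, ← orthomorphism_posPart_inf_negPart_of_le hT hy h2]
      exact inf_le_inf_left _ inf_le_right
    · refine le_antisymm ?_ (le_inf (abs_nonneg _) (abs_nonneg _))
      have h3 := orthomorphism_posPart_inf_negPart_of_le (Submodule.neg_mem _ hT) hx h1
      have h4 : (-T).1 = -T.1 := rfl
      rw [h4, LinearMap.neg_apply, LinearMap.neg_apply, posPart_neg, negPart_neg] at h3
      rw [abs_negPart, abs_of_nonneg hw0, ← h3]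
      exact inf_le_inf_left _ inf_le_left
  -- Two common upper bounds of `x` and `y` that differ by `y`: thus `T y` is disjoint from `w`,
  -- while `w ≤ (T y)⁻`.
  have h1 := key (x + y) (le_add_of_nonneg_right hy) (le_add_of_nonneg_left hx)
  have h2 := key (x + y + y) ((le_add_of_nonneg_right hy).trans (le_add_of_nonneg_right hy))
    (le_add_of_nonneg_left (add_nonneg hx hy))
  have h3 := Submodule.sub_mem _ h2 h1
  rw [← map_sub, add_sub_cancel_left] at h3
  refine eq_zero_of_mem_disjointComplement_of_abs_le h3 ?_
  rw [abs_of_nonneg hw0]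
  exact inf_le_right.trans (negPart_le_abs _)

/-- In `(T y)⁺ ≤ (T x)⁺ + (T (x - y))⁻` the last term is disjoint from the left side by locality and
drops out. -/
theorem orthomorphism_apply_le_posPart {T : orderBoundedOperators E E} (hT : T ∈ orthomorphisms E)
    {x y : E} (hy : 0 ≤ y) (hyx : y ≤ x) : T.1 y ≤ (T.1 x)⁺ := by
  refine (le_posPart _).trans ?_
  have h1 := orthomorphism_posPart_inf_negPart hT hy (sub_nonneg.2 hyx)
  have h2 : (T.1 y)⁺ ≤ (T.1 x)⁺ + (T.1 (x - y))⁻ := by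
    refine sup_le_iff.2 ⟨?_, add_nonneg (posPart_nonneg _) (negPart_nonneg _)⟩
    have e : T.1 y = T.1 x + -T.1 (x - y) := by rw [map_sub]; abel
    calc T.1 y = T.1 x + -T.1 (x - y) := e
      _ ≤ _ := add_le_add (le_posPart _) (neg_le_negPart _)
  calc (T.1 y)⁺ ≤ ((T.1 x)⁺ + (T.1 (x - y))⁻) ⊓ (T.1 y)⁺ := le_inf h2 le_rfl
    _ ≤ (T.1 x)⁺ ⊓ (T.1 y)⁺ + (T.1 (x - y))⁻ ⊓ (T.1 y)⁺ :=
      add_inf_le (posPart_nonneg _) (negPart_nonneg _) (posPart_nonneg _)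
    _ ≤ (T.1 x)⁺ := by
      rw [inf_comm (T.1 (x - y))⁻, h1, add_zero]
      exact inf_le_left

theorem posOp_apply_of_mem_orthomorphisms {T : orderBoundedOperators E E}
    (hT : T ∈ orthomorphisms E) {x : E} (hx : 0 ≤ x) : (posOp T).1 x = (T.1 x)⁺ := by
  rw [posOp_apply T hx]
  refine le_antisymm ((rk_isLUB T hx).2 ?_) (sup_le_iff.2 ⟨le_rk T hx, rk_nonneg T hx⟩)
  rintro _ ⟨y, hy, rfl⟩
  exact orthomorphism_apply_le_posPart hT hy.1 hy.2

theorem sup_apply_of_mem_orthomorphisms {T S : orderBoundedOperators E E}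
    (hT : T ∈ orthomorphisms E) (hS : S ∈ orthomorphisms E) {x : E} (hx : 0 ≤ x) :
    (T ⊔ S).1 x = T.1 x ⊔ S.1 x := by
  have h := posOp_apply_of_mem_orthomorphisms (Submodule.sub_mem _ hS hT) hx
  have e : (T ⊔ S).1 x = T.1 x + (posOp (S - T)).1 x := rfl
  have e' : (S - T).1 x = S.1 x - T.1 x := rfl
  rw [e, h, e', sup_comm, sup_eq_add_posPart_sub]

theorem inf_apply_of_mem_orthomorphisms {T S : orderBoundedOperators E E}
    (hT : T ∈ orthomorphisms E) (hS : S ∈ orthomorphisms E) {x : E} (hx : 0 ≤ x) :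
    (T ⊓ S).1 x = T.1 x ⊓ S.1 x := by
  have h := posOp_apply_of_mem_orthomorphisms (Submodule.sub_mem _ hT hS) hx
  have e : (T ⊓ S).1 x = T.1 x - (posOp (T - S)).1 x := rfl
  have e' : (T - S).1 x = T.1 x - S.1 x := rfl
  rw [e, h, e', inf_eq_sub_posPart_sub]

theorem abs_mem_orthomorphisms {T : orderBoundedOperators E E} (hT : T ∈ orthomorphisms E) :
    |T| ∈ orthomorphisms E :=
  Submodule.add_mem _ hT (posOp_mem_orthomorphisms
    (Submodule.sub_mem _ (Submodule.neg_mem _ hT) hT))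

theorem abs_apply_of_mem_orthomorphisms {T : orderBoundedOperators E E}
    (hT : T ∈ orthomorphisms E) {x : E} (hx : 0 ≤ x) : |T|.1 x = |T.1 x| :=
  sup_apply_of_mem_orthomorphisms hT (Submodule.neg_mem _ hT) hx

/-- `T x⁺` and `T x⁻` inherit disjointness from `x⁺` and `x⁻`, so their sum and difference have
equal modulus. -/
theorem abs_apply_eq_of_mem_orthomorphisms {T : orderBoundedOperators E E}
    (hT : T ∈ orthomorphisms E) (x : E) : |T.1 x| = |T|.1 |x| := by
  have h : |T.1 x⁺| ⊓ |T.1 x⁻| = 0 :=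
    orthomorphism_mem_disjointComplement hT (mem_disjointComplement_comm.1
      (orthomorphism_mem_disjointComplement hT (negPart_mem_disjointComplement_posPart x)))
  rw [abs_apply_of_mem_orthomorphisms hT (abs_nonneg x), ← posPart_add_negPart x, map_add]
  conv_lhs => rw [← posPart_sub_negPart x, map_sub]
  exact (abs_add_eq_abs_sub_of_disjoint h).symm

theorem mem_orthomorphisms_of_le {T S : orderBoundedOperators E E} (hT : T ∈ orthomorphisms E)
    (hS : 0 ≤ S) (hST : S ≤ T) : S ∈ orthomorphisms E := by
  intro B hB x hx
  have hpos : ∀ z : E, 0 ≤ z → z ∈ B → S.1 z ∈ B := by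
    intro z hz hzB
    refine hB.solid (hT B hB z hzB) ?_
    have h1 : 0 ≤ S.1 z := hS z hz
    rw [abs_of_nonneg h1, abs_of_nonneg (h1.trans (hST z hz))]
    exact hST z hz
  rw [← posPart_sub_negPart x, map_sub]
  refine B.sub_mem (hpos _ (posPart_nonneg x) (hB.solid hx ?_))
    (hpos _ (negPart_nonneg x) (hB.solid hx ?_))
  · rw [abs_posPart]
    exact posPart_le_abs x
  · rw [abs_negPart]
    exact negPart_le_abs x

end Locality

/-! ### Extension from the positive cone -/

section Kantorovich

variable {E : Type u} [Lattice E] [AddCommGroup E] [IsOrderedAddMonoid E] [Module ℝ E]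
  [IsOrderedModule ℝ E]

/-- An additive and positively homogeneous map on the positive cone extends to a linear map. -/
theorem exists_linearMap_eqOn_nonneg {F : Type v} [AddCommGroup F] [Module ℝ F] (p : E → F)
    (hadd : ∀ x y, 0 ≤ x → 0 ≤ y → p (x + y) = p x + p y)
    (hsmul : ∀ (c : ℝ) x, 0 < c → 0 ≤ x → p (c • x) = c • p x) :
    ∃ L : E →ₗ[ℝ] F, ∀ x, 0 ≤ x → L x = p x := by
  have hsub : ∀ {a b c d : E}, 0 ≤ a → 0 ≤ b → 0 ≤ c → 0 ≤ d → a - b = c - d →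
      p a - p b = p c - p d := by
    intro a b c d ha hb hc hd h
    rw [sub_eq_sub_iff_add_eq_add] at h ⊢
    rw [← hadd _ _ ha hd, ← hadd _ _ hc hb, h]
  have h0 : p 0 = 0 := by simpa using hadd 0 0 le_rfl le_rfl
  have hP : ∀ x : E, 0 ≤ x⁺ := posPart_nonneg
  have hN : ∀ x : E, 0 ≤ x⁻ := negPart_nonneg
  refine ⟨⟨⟨fun x => p x⁺ - p x⁻, fun x y => ?_⟩, fun r x => ?_⟩, fun x hx => ?_⟩
  · rw [hsub (c := x⁺ + y⁺) (d := x⁻ + y⁻) (hP _) (hN _) (add_nonneg (hP _) (hP _))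
      (add_nonneg (hN _) (hN _)) (by rw [posPart_sub_negPart, add_sub_add_comm,
        posPart_sub_negPart, posPart_sub_negPart]), hadd _ _ (hP _) (hP _), hadd _ _ (hN _) (hN _)]
    abel
  · simp only [RingHom.id_apply]
    rcases lt_trichotomy r 0 with hr | rfl | hr
    · have hr' : 0 < -r := neg_pos.2 hr
      rw [hsub (c := (-r) • x⁻) (d := (-r) • x⁺) (hP _) (hN _) (smul_nonneg hr'.le (hN _))
        (smul_nonneg hr'.le (hP _)) (by rw [posPart_sub_negPart, ← smul_sub, neg_smul, ← smul_neg,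
          neg_sub, posPart_sub_negPart]), hsmul _ _ hr' (hN _), hsmul _ _ hr' (hP _), ← smul_sub,
        neg_smul, ← smul_neg, neg_sub]
    · simp
    · rw [hsub (c := r • x⁺) (d := r • x⁻) (hP _) (hN _) (smul_nonneg hr.le (hP _))
        (smul_nonneg hr.le (hN _)) (by rw [posPart_sub_negPart, ← smul_sub, posPart_sub_negPart]),
        hsmul _ _ hr (hP _), hsmul _ _ hr (hN _), smul_sub]
  · change p x⁺ - p x⁻ = p x
    rw [posPart_of_nonneg hx, negPart_eq_zero.2 hx, h0, sub_zero]

end Kantorovich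

/-! ### Pointwise suprema of orthomorphisms -/

section Orthomorphisms

variable {E : Type u} [ConditionallyCompleteLattice E] [AddCommGroup E] [IsOrderedAddMonoid E]
  [Module ℝ E] [IsOrderedModule ℝ E]

/-- Bounded suprema of positive orthomorphisms are computed pointwise on the positive cone. -/
theorem exists_isLUB_apply_of_orthomorphisms {J : Type v} [Nonempty J]
    (S : J → orderBoundedOperators E E) (hS : ∀ j, S j ∈ orthomorphisms E) (h0 : ∀ j, 0 ≤ S j)
    {Y : orderBoundedOperators E E} (hY : ∀ j, S j ≤ Y) :
    ∃ U : orderBoundedOperators E E,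
      ∀ x, 0 ≤ x → IsLUB (Set.range fun j => (S j).1 x) (U.1 x) := by
  obtain ⟨j₀⟩ := ‹Nonempty J›
  let p : E → E := fun x => sSup (Set.range fun j => (S j).1 x)
  have hp : ∀ x, 0 ≤ x → IsLUB (Set.range fun j => (S j).1 x) (p x) := fun x hx =>
    isLUB_csSup ⟨_, j₀, rfl⟩ ⟨Y.1 x, by rintro _ ⟨j, rfl⟩; exact hY j x hx⟩
  have hp0 : ∀ x, 0 ≤ x → 0 ≤ p x := fun x hx => (h0 j₀ x hx).trans ((hp x hx).1 ⟨j₀, rfl⟩)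
  have hadd : ∀ x y, 0 ≤ x → 0 ≤ y → p (x + y) = p x + p y := by
    intro x y hx hy
    have hxy := add_nonneg hx hy
    refine le_antisymm ((hp _ hxy).2 ?_) ?_
    · rintro _ ⟨j, rfl⟩
      change (S j).1 (x + y) ≤ _
      rw [map_add]
      exact add_le_add ((hp x hx).1 ⟨j, rfl⟩) ((hp y hy).1 ⟨j, rfl⟩)
    · rw [← le_sub_iff_add_le]
      refine (hp x hx).2 ?_
      rintro _ ⟨i, rfl⟩
      rw [le_sub_comm]
      refine (hp y hy).2 ?_
      rintro _ ⟨j, rfl⟩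
      rw [le_sub_iff_add_le]
      -- Pointwise binary suprema replace directedness of the family: `(S i ⊔ S j) (x + y)` is the
      -- larger of two values already below `p (x + y)`.
      calc (S j).1 y + (S i).1 x ≤ (S i ⊔ S j).1 y + (S i ⊔ S j).1 x :=
            add_le_add ((le_sup_right : S j ≤ S i ⊔ S j) y hy)
              ((le_sup_left : S i ≤ S i ⊔ S j) x hx)
        _ = (S i).1 (x + y) ⊔ (S j).1 (x + y) := by
            rw [← map_add, add_comm y x, sup_apply_of_mem_orthomorphisms (hS i) (hS j) hxy]
        _ ≤ p (x + y) := sup_le ((hp _ hxy).1 ⟨i, rfl⟩) ((hp _ hxy).1 ⟨j, rfl⟩)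
  have key : ∀ (c : ℝ) x, 0 < c → 0 ≤ x → p (c • x) ≤ c • p x := by
    intro c x hc hx
    refine (hp _ (smul_nonneg hc.le hx)).2 ?_
    rintro _ ⟨j, rfl⟩
    change (S j).1 (c • x) ≤ _
    rw [map_smul]
    exact smul_le_smul_of_nonneg_left ((hp x hx).1 ⟨j, rfl⟩) hc.le
  have hsmul : ∀ (c : ℝ) x, 0 < c → 0 ≤ x → p (c • x) = c • p x := by
    intro c x hc hx
    refine le_antisymm (key c x hc hx) ?_
    have h := key c⁻¹ (c • x) (inv_pos.2 hc) (smul_nonneg hc.le hx)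
    rwa [inv_smul_smul₀ hc.ne', le_inv_smul_iff_of_pos hc] at h
  obtain ⟨L, hL⟩ := exists_linearMap_eqOn_nonneg p hadd hsmul
  have hmono : Monotone L := by
    intro x y h
    rw [← sub_nonneg, ← map_sub, hL _ (sub_nonneg.2 h)]
    exact hp0 _ (sub_nonneg.2 h)
  refine ⟨⟨L, fun _ h₁ h₂ => ⟨hmono.map_bddBelow h₁, hmono.map_bddAbove h₂⟩⟩, fun x hx => ?_⟩
  change IsLUB _ (L x)
  rw [hL x hx]
  exact hp x hx

variable (E) in
/-- The identity as an order bounded operator. -/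
def idOp : orderBoundedOperators E E :=
  ⟨LinearMap.id, fun s h₁ h₂ => by simpa using ⟨h₁, h₂⟩⟩

theorem idOp_mem_orthomorphisms : idOp E ∈ orthomorphisms E := fun _ _ _ hx => hx

theorem idOp_nonneg : 0 ≤ idOp E := fun _ hx => hx

/-! ### Implications between the modes of convergence -/

variable {ι : Type v} [Preorder ι] [Nonempty ι]

theorem nonpos_of_mem_disjointComplement {T : ι → orthomorphisms E} {x y z : E} (hz0 : 0 ≤ z)
    (hz : ∀ u, (∃ a₀, ∀ a, a₀ ≤ a → |(T a).1.1 x| ⊓ y ≤ u) → z ≤ u)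
    (hxz : x ∈ disjointComplement z) : z ≤ 0 := by
  obtain ⟨a₀⟩ := ‹Nonempty ι›
  rw [← inf_idem z]
  refine inf_le_of_tail_inf_le hz ⟨a₀, fun a _ => ?_⟩
  have h : |(T a).1.1 x| ⊓ |z| = 0 := orthomorphism_mem_disjointComplement (T a).2 hxz
  rw [abs_of_nonneg hz0] at h
  rw [← h]
  exact inf_le_inf_right z inf_le_left

variable [IsDirectedOrder ι]

theorem uoTendsto_apply_of_uoTendsto_orthomorphisms {T : ι → orthomorphisms E}
    (h : UOTendsto T 0) (x : E) : UOTendsto (fun a => (T a).1.1 x) 0 := by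
  refine uoTendsto_zero_of fun y z hy hz0 hz => ?_
  let I : orthomorphisms E := ⟨idOp E, idOp_mem_orthomorphisms⟩
  have hI : 0 ≤ I := idOp_nonneg
  -- Bounds are cut down to `V ≤ I` so that the `I - V` are positive and bounded by `I`; their
  -- pointwise supremum `W` encodes the infimum of the `V`.
  let J := {V : orthomorphisms E // (∃ a₀, ∀ a, a₀ ≤ a → |T a| ⊓ I ≤ V) ∧ V ≤ I}
  have : Nonempty J := ⟨⟨I, ⟨Classical.arbitrary ι, fun _ _ => inf_le_right⟩, le_rfl⟩⟩
  have hJ0 : ∀ V : J, 0 ≤ V.1 := by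
    rintro ⟨V, ⟨a₀, ha⟩, -⟩
    exact (le_inf (abs_nonneg _) hI).trans (ha a₀ le_rfl)
  obtain ⟨W, hW⟩ := exists_isLUB_apply_of_orthomorphisms (fun V : J => (I - V.1).1)
    (fun V => (I - V.1).2) (fun V => show (0 : orthomorphisms E) ≤ I - V.1 from sub_nonneg.2 V.2.2)
    (Y := idOp E) (fun V => show I - V.1 ≤ I from sub_le_self I (hJ0 V))
  have hW0 : 0 ≤ W := by
    intro w hw
    obtain ⟨V⟩ := this
    exact (sub_nonneg.2 V.2.2 : 0 ≤ I - V.1) w hw |>.trans ((hW w hw).1 ⟨V, rfl⟩)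
  have hWI : W ≤ idOp E := by
    intro w hw
    refine (hW w hw).2 ?_
    rintro _ ⟨V, rfl⟩
    exact (sub_le_self I (hJ0 V) : I - V.1 ≤ I) w hw
  let W' : orthomorphisms E := ⟨W, mem_orthomorphisms_of_le idOp_mem_orthomorphisms hW0 hWI⟩
  have hIW : I - W' ≤ 0 := by
    refine h.nonpos hI fun u hu => ?_
    obtain ⟨a₀, ha⟩ := hu
    let V : J := ⟨u ⊓ I, ⟨a₀, fun a h => le_inf (ha a h) inf_le_right⟩, inf_le_right⟩
    have hV : I - u ⊓ I ≤ W' := fun w hw => (hW w hw).1 ⟨V, rfl⟩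
    exact ((sub_le_comm (a := I) (b := u ⊓ I) (c := W')).1 hV).trans inf_le_left
  have hIx : |x| ≤ W.1 |x| := (sub_nonpos.1 hIW : I ≤ W') |x| (abs_nonneg x)
  -- Each `V |x|` dominates `z ⊓ |x|`, so `|x| ≤ W |x| ≤ |x| - z ⊓ |x|`.
  have hzx : z ⊓ |x| ≤ 0 := by
    have h1 : W.1 |x| ≤ |x| - z ⊓ |x| := by
      refine (hW _ (abs_nonneg x)).2 ?_
      rintro _ ⟨V, rfl⟩
      obtain ⟨a₀, ha⟩ := V.2.1
      change |x| - V.1.1.1 |x| ≤ |x| - z ⊓ |x|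
      refine sub_le_sub_left (inf_le_of_tail_inf_le hz ⟨a₀, fun a h => ?_⟩) _
      refine le_trans ?_ (ha a h |x| (abs_nonneg x))
      change _ ≤ (|(T a).1| ⊓ idOp E).1 |x|
      rw [inf_apply_of_mem_orthomorphisms (abs_mem_orthomorphisms (T a).2)
        idOp_mem_orthomorphisms (abs_nonneg x), ← abs_apply_eq_of_mem_orthomorphisms (T a).2]
      exact inf_le_inf_right _ inf_le_left
    simpa using hIx.trans h1
  refine nonpos_of_mem_disjointComplement hz0 hz ?_
  rw [mem_disjointComplement, abs_of_nonneg hz0, inf_comm]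
  exact le_antisymm hzx (le_inf hz0 (abs_nonneg x))

theorem uoTendsto_orderBounded_of_uoTendsto_apply {T : ι → orthomorphisms E}
    (h : ∀ x, UOTendsto (fun a => (T a).1.1 x) 0) :
    UOTendsto (fun a => (T a : orderBoundedOperators E E)) 0 := by
  refine uoTendsto_zero_of fun Y Z hY hZ0 hZ x hx => ?_
  refine (h x).nonpos (y := Y.1 x) (hY x hx) fun u hu => ?_
  obtain ⟨a₀, ha⟩ := hu
  have : Nonempty {a // a₀ ≤ a} := ⟨⟨a₀, le_rfl⟩⟩
  obtain ⟨U, hU⟩ := exists_isLUB_apply_of_orthomorphisms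
    (fun a : {a // a₀ ≤ a} => |(T a.1).1| ⊓ Y)
    (fun a => mem_orthomorphisms_of_le (abs_mem_orthomorphisms (T a.1).2)
      (le_inf (abs_nonneg _) hY) inf_le_left)
    (fun a => le_inf (abs_nonneg _) hY) (Y := Y) (fun a => inf_le_right)
  -- `U` is the supremum of the tail from `a₀`, hence itself an eventual bound.
  have h1 : Z ≤ U := hZ U ⟨a₀, fun a h x hx => (hU x hx).1 ⟨⟨a, h⟩, rfl⟩⟩
  refine (h1 x hx).trans ((hU x hx).2 ?_)
  rintro _ ⟨⟨a, h⟩, rfl⟩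
  refine le_trans (le_inf ?_ ?_) (ha a h)
  · rw [← abs_apply_of_mem_orthomorphisms (T a).2 hx]
    exact (inf_le_left : |(T a).1| ⊓ Y ≤ _) x hx
  · exact (inf_le_right : |(T a).1| ⊓ Y ≤ _) x hx

theorem uoTendsto_orthomorphisms_of_uoTendsto_orderBounded {T : ι → orthomorphisms E}
    (h : UOTendsto (fun a => (T a : orderBoundedOperators E E)) 0) : UOTendsto T 0 := by
  refine uoTendsto_zero_of fun Y Z hY hZ0 hZ => ?_
  refine (h.nonpos (y := Y.1) (z := Z.1) hY fun u hu => ?_ : Z.1 ≤ 0)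
  obtain ⟨a₀, ha⟩ := hu
  have h0 : 0 ≤ u ⊓ Y.1 := 
    le_inf ((le_inf (abs_nonneg (T a₀).1) hY).trans (ha a₀ le_rfl)) hY
  have h1 : Z ≤ ⟨u ⊓ Y.1, mem_orthomorphisms_of_le Y.2 h0 inf_le_right⟩ :=
    hZ _ ⟨a₀, fun a h => show |(T a).1| ⊓ Y.1 ≤ u ⊓ Y.1 from le_inf (ha a h) inf_le_right⟩
  exact (show Z.1 ≤ u ⊓ Y.1 from h1).trans inf_le_left

theorem uoTendsto_apply_of_bandGenerated_eq_top {T : ι → orthomorphisms E} {S : Set E}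
    (hS : bandGenerated S = ⊤) (h : ∀ s ∈ S, UOTendsto (fun a => (T a).1.1 s) 0) (x : E) :
    UOTendsto (fun a => (T a).1.1 x) 0 := by
  refine uoTendsto_zero_of fun y z hy hz0 hz => ?_
  refine (eq_zero_of_disjoint_of_bandGenerated_eq_top hS fun s hs => ?_).le
  have hs0 := abs_nonneg s
  have hx0 := abs_nonneg x
  rw [mem_disjointComplement, abs_of_nonneg hz0, inf_comm]
  refine le_antisymm (nonpos_of_nsmul_le (g := |x|) fun n => ?_) (le_inf hz0 hs0)
  -- `v` is carried by the region where `(n + 1) • |s|` exceeds `|x|`. There `|T a x|` is controlled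
  -- by `(n + 1) • |T a s|`, so `z` must be disjoint from `v`.
  set v := ((n + 1) • |s| - |x|)⁺ with hv
  have hv0 : 0 ≤ v := posPart_nonneg _
  have hzv : z ⊓ v ≤ 0 := by
    have hn : (0 : ℝ) < ((n + 1 : ℕ) : ℝ) := by positivity
    have h1 : (((n + 1 : ℕ) : ℝ)⁻¹) • (z ⊓ v) ≤ 0 := by
      refine (h s hs).nonpos hy fun u hu => ?_
      obtain ⟨a₀, ha⟩ := hu
      rw [inv_smul_le_iff_of_pos hn, Nat.cast_smul_eq_nsmul]
      refine inf_le_of_tail_inf_le hz ⟨a₀, fun a h => ?_⟩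
      have hR := abs_mem_orthomorphisms (T a).2
      have hR0 : 0 ≤ |(T a).1| := abs_nonneg _
      have hb0 : 0 ≤ |x| ⊓ (n + 1) • |s| := le_inf hx0 (nsmul_nonneg hs0 _)
      have hc0 : 0 ≤ (|x| - (n + 1) • |s|)⁺ := posPart_nonneg _
      have hyv : 0 ≤ y ⊓ v := le_inf hy hv0
      have hb : |(T a).1|.1 (|x| ⊓ (n + 1) • |s|) ⊓ (y ⊓ v) ≤ (n + 1) • u := by
        have h2 : |(T a).1|.1 (|x| ⊓ (n + 1) • |s|) ≤ (n + 1) • |(T a).1.1 s| := by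
          rw [abs_apply_eq_of_mem_orthomorphisms (T a).2, ← map_nsmul, ← sub_nonneg, ← map_sub]
          exact hR0 _ (sub_nonneg.2 inf_le_right)
        exact (inf_le_inf h2 inf_le_left).trans ((nsmul_inf_le (abs_nonneg _) hy _).trans
          (nsmul_le_nsmul_right (ha a h) _))
      have hc : |(T a).1|.1 (|x| - (n + 1) • |s|)⁺ ⊓ (y ⊓ v) ≤ 0 := by
        have h2 : (|x| - (n + 1) • |s|)⁺ ∈ disjointComplement v := by
          have := negPart_mem_disjointComplement_posPart ((n + 1) • |s| - |x|)
          rwa [← posPart_neg, neg_sub] at this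
        have h3 := mem_disjointComplement.1 (orthomorphism_mem_disjointComplement hR h2)
        rw [abs_of_nonneg (hR0 _ hc0), abs_of_nonneg hv0] at h3
        exact (inf_le_inf_left _ inf_le_right).trans h3.le
      have hx : |(T a).1.1 x| = |(T a).1|.1 (|x| ⊓ (n + 1) • |s|)
          + |(T a).1|.1 (|x| - (n + 1) • |s|)⁺ := by
        rw [abs_apply_eq_of_mem_orthomorphisms (T a).2, ← map_add, inf_eq_sub_posPart_sub,
          sub_add_cancel]
      rw [inf_assoc, hx]
      exact (add_inf_le (hR0 _ hb0) (hR0 _ hc0) hyv).trans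
        ((add_le_add hb hc).trans (add_zero _).le)
    rwa [inv_smul_le_iff_of_pos hn, smul_zero] at h1
  have hr0 : 0 ≤ z ⊓ |s| := le_inf hz0 hs0
  have h1 : (n + 1) • (z ⊓ |s|) ≤ v + |x| := by
    refine (nsmul_le_nsmul_right inf_le_right _).trans ?_
    rw [← sub_le_iff_le_add]
    exact le_posPart _
  -- Disjointness from `v` removes `v` from the bound `v + |x|`, leaving a bound `|x|` independent
  -- of `n`.
  have h2 : v ⊓ ((n + 1) • (z ⊓ |s|)) ≤ 0 := by
    rw [inf_comm]
    refine (nsmul_inf_le hr0 hv0 _).trans (nsmul_nonpos ?_ _)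
    exact (inf_le_inf_right v inf_le_left).trans hzv
  calc (n + 1) • (z ⊓ |s|) ≤ (v + |x|) ⊓ ((n + 1) • (z ⊓ |s|)) := le_inf h1 le_rfl
    _ ≤ v ⊓ ((n + 1) • (z ⊓ |s|)) + |x| ⊓ ((n + 1) • (z ⊓ |s|)) :=
      add_inf_le hv0 hx0 (nsmul_nonneg hr0 _)
    _ ≤ 0 + |x| := add_le_add h2 inf_le_left
    _ = |x| := zero_add _

end Orthomorphisms

end VectorLattice

theorem mainTheorem6
    {E : Type*} [ConditionallyCompleteLattice E] [AddCommGroup E] [IsOrderedAddMonoid E]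
    [Module ℝ E] [IsOrderedModule ℝ E]
    {ι : Type*} [Preorder ι] [IsDirectedOrder ι] [Nonempty ι]
    (T : ι → orthomorphisms E) :
    (∀ S : Set E, S.Nonempty → bandGenerated S = ⊤ →
      List.TFAE [
        UOTendsto T 0,
        UOTendsto (fun α => (T α : orderBoundedOperators E E)) 0,
        ∀ s ∈ S, UOTendsto (fun α => (T α).1.1 s) 0,
        ∀ x : E, UOTendsto (fun α => (T α).1.1 x) 0]) ∧
    (∀ e : E, IsWeakOrderUnit e →
      (UOTendsto T 0 ↔ UOTendsto (fun α => (T α).1.1 e) 0)) := by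
  refine ⟨fun S _ hS => ?_, fun e he => ⟨fun h =>
    uoTendsto_apply_of_uoTendsto_orthomorphisms h e, fun h => ?_⟩⟩
  · tfae_have 1 → 4 := uoTendsto_apply_of_uoTendsto_orthomorphisms
    tfae_have 4 → 2 := uoTendsto_orderBounded_of_uoTendsto_apply
    tfae_have 2 → 1 := uoTendsto_orthomorphisms_of_uoTendsto_orderBounded
    tfae_have 4 → 3 := fun h s _ => h s
    tfae_have 3 → 4 := uoTendsto_apply_of_bandGenerated_eq_top hS
    tfae_finish
  · refine uoTendsto_orthomorphisms_of_uoTendsto_orderBounded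
      (uoTendsto_orderBounded_of_uoTendsto_apply
        (uoTendsto_apply_of_bandGenerated_eq_top he ?_))
    rintro _ rfl
    exact h
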